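/- There exists a separable real Banach space with an unconditional basis which is not isomorphic to a subspace of $\ell_1$ and which contains no equilateral sequence, that is, no sequence $(x_m)_{m\ge 1}$ of distinct points such that, for some $\lambda>0$, $\|x_m-x_k\|=\lambda$ for all $m\neq k$. More precisely, let $2<p<\infty$, and for $n\ge 1$ let $X_n=\ell_p^n$ be $\mathbb{R}^n$ with its $\ell_p$-norm, denoted by $\|\cdot\|_n$. On the space $c_{00}((X_n))$ of finitely supported sequences $(x_1,x_2,\dots)$ with $x_n\in X_n$, define a norm by $\|(x_1)\|=\|x_1\|_1$ and, for $n\ge 2$, $$\|(x_1,\dots,x_n)\|=\Bigl(1-\frac1{n+1}\Bigr)\bigl(\|x_n\|_n+\|(x_1,\dots,x_{n-1})\|\bigr)+\frac1{n+1}\max\Bigl\{\frac{\|x_n\|_n}{n},\ \|(x_1,\dots,x_{n-1})\|\Bigr\}.$$ Then the completion $X$ of $(c_{00}((X_n)),\|\cdot\|)$ is a separable Banach space with an unconditional basis, it contains no equilateral sequence, and it is not isomorphic to (that is, not linearly homeomorphic to) any linear subspace of $\ell_1$. -/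

import Mathlib

open scoped ENNReal

/-- A subset `S` of a normed space is equilateral if, for some `r > 0`, any two distinct points
of `S` are at distance `r`. -/
def IsEquilateral {X : Type*} [NormedAddCommGroup X] (S : Set X) : Prop :=
  ∃ r : ℝ, 0 < r ∧ ∀ x ∈ S, ∀ y ∈ S, x ≠ y → ‖x - y‖ = r

/-- `X` contains an equilateral sequence: a sequence of distinct points whose range is
equilateral. -/
def HasEquilateralSequence (X : Type*) [NormedAddCommGroup X] : Prop :=
  ∃ x : ℕ → X, Function.Injective x ∧ IsEquilateral (Set.range x)

/-- The real Banach space of absolutely summable real sequences. -/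
abbrev EllOne : Type := lp (fun _ : ℕ => ℝ) 1

/-- `X` is linearly homeomorphic to a linear subspace of `Y` (with the norm of `Y`). -/
def IsIsomorphicToSubspace (X Y : Type*) [NormedAddCommGroup X] [NormedSpace ℝ X]
    [NormedAddCommGroup Y] [NormedSpace ℝ Y] : Prop :=
  ∃ V : Submodule ℝ Y, Nonempty (X ≃L[ℝ] V)

/-- Terenzi's recursion. The spaces are numbered from `0`, so `E k` is the `(k + 1)`-st space
and `terenziNorm x k` is the norm of the vector `(x 0, …, x k)` of length `k + 1`:
with `n = k + 2`, the norm of a vector of length `n ≥ 2` is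
`(1 - 1 / (n + 1)) * (‖last‖ + N) + 1 / (n + 1) * max (‖last‖ / n) N`,
where `N` is the norm of the vector without its last entry. -/
noncomputable def terenziNorm {E : ℕ → Type*} [∀ k, NormedAddCommGroup (E k)]
    (x : ∀ k, E k) : ℕ → ℝ
  | 0 => ‖x 0‖
  | k + 1 =>
      (1 - 1 / ((k : ℝ) + 3)) * (‖x (k + 1)‖ + terenziNorm x k) +
        1 / ((k : ℝ) + 3) * max (‖x (k + 1)‖ / ((k : ℝ) + 2)) (terenziNorm x k)

/-- The Banach space `X` is the completion of the space of finitely supported sequences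
`(x 0, x 1, …)`, `x k ∈ E k`, under Terenzi's norm: these sequences map linearly and
isometrically onto a dense subspace of `X`. Appending zeros to a finite sequence does not change
its norm, so the norm is read off at any `k` beyond which `x` vanishes. -/
def IsTerenziSum (E : ℕ → Type*) [∀ k, NormedAddCommGroup (E k)] [∀ k, NormedSpace ℝ (E k)]
    (X : Type*) [NormedAddCommGroup X] [NormedSpace ℝ X] : Prop :=
  CompleteSpace X ∧
    ∃ ι : (Π₀ k, E k) →ₗ[ℝ] X, DenseRange ι ∧
      ∀ (x : Π₀ k, E k) (k : ℕ), (∀ j, k < j → x j = 0) → ‖ι x‖ = terenziNorm (⇑x) k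

/-!
The space is the `ℓ¹`-sum of the spaces `ℓₚⁿ`, renormed. One step of Terenzi's recursion adds to
the norm `N` of the initial part a quantity between `(1 - 1 / (n + 1)) * ‖xₙ‖` and `‖xₙ‖`, so the
recursion increases to a limit that is equivalent to the `ℓ¹`-norm. Completeness, separability and
the unconditional basis of unit vectors are therefore those of the `ℓ¹`-sum, and finitely supported
sequences are dense.

*Equilateral sequences.* Let `x m` have mutual distances `r`. After passing to a subsequence and
translating by its coordinatewise limit, one has vectors `z m` that tend to `0` coordinatewise and
whose norms converge to some `L`. At infinity the norm is asymptotically that of an `ℓ¹`-sum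
(`eventually_add_le_terenziLimit_sub`), so `r = ‖z m - z k‖` tends to `‖z m‖ + L` as `k → ∞`.
Hence all the norms `‖z m‖` are equal to `L = r / 2`, and `‖z m - z k‖ = ‖z m‖ + ‖z k‖` for
`m ≠ k`. Such an equality is inherited by every stage of the recursion
(`terenziNorm_sub_eq_of_terenziLimit_sub_eq`): a defect at one stage can only shrink while the
maximum in the recursion is attained at the new coordinate, which happens finitely often. So the
equality holds at each coordinate too. As `ℓₚⁿ` is strictly convex (`PiLp.strictConvexSpace`), at
most two of the `z m` are nonzero at a given coordinate, and there is a `z k` that vanishes as far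
as desired. At its first nonzero coordinate, the term `‖z k n‖ / n` enters the maximum for `z k`
but not the one for `z m - z k`, where the norm of the initial part of `z m` is larger. This breaks
the equality (`not_forall_terenziLimit_sub_eq_add`).

*Subspaces of `ℓ¹`.* By Khinchine's inequality (`khinchine_one`), `n` vectors of `ℓ¹` with norms
bounded below have, for some choice of signs, a signed sum of norm at least of order `√n`
(`exists_units_sum_norm_le`). The unit vectors of `ℓₚⁿ` have signed sums of norm `n ^ (1 / p)`,
which is of smaller order since `2 < p`.
-/

open Filter Topology

/-! ### The recursion on finite sequences -/

section TerenziNorm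

variable {E : ℕ → Type*} [∀ k, NormedAddCommGroup (E k)]

lemma terenziNorm_nonneg (x : ∀ k, E k) (n : ℕ) : 0 ≤ terenziNorm x n := by
  induction n with
  | zero => exact norm_nonneg _
  | succ n ih =>
    have h : (1 : ℝ) / ((n : ℝ) + 3) ≤ 1 := by
      rw [div_le_one (by positivity)]; linarith [n.cast_nonneg (α := ℝ)]
    have h' : (0 : ℝ) ≤ 1 - 1 / ((n : ℝ) + 3) := by linarith
    simp only [terenziNorm]
    positivity

lemma one_sub_one_div_add_three_pos (n : ℕ) : (0 : ℝ) < 1 - 1 / ((n : ℝ) + 3) := by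
  rw [sub_pos, div_lt_one (by positivity)]; linarith [n.cast_nonneg (α := ℝ)]

/-- The lower estimate for one step of the recursion. -/
lemma terenziNorm_add_le_succ (x : ∀ k, E k) (n : ℕ) :
    terenziNorm x n + (1 - 1 / ((n : ℝ) + 3)) * ‖x (n + 1)‖ ≤ terenziNorm x (n + 1) := by
  have h : 1 / ((n : ℝ) + 3) * terenziNorm x n ≤
      1 / ((n : ℝ) + 3) * max (‖x (n + 1)‖ / ((n : ℝ) + 2)) (terenziNorm x n) := by
    gcongr; exact le_max_right _ _
  simp only [terenziNorm]
  linarith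

/-- As soon as the maximum in the recursion is attained at the norm of the initial part, the
lower estimate for one step is an equality. -/
lemma terenziNorm_succ_of_le {x : ∀ k, E k} {n : ℕ}
    (h : ‖x (n + 1)‖ / ((n : ℝ) + 2) ≤ terenziNorm x n) :
    terenziNorm x (n + 1) = terenziNorm x n + (1 - 1 / ((n : ℝ) + 3)) * ‖x (n + 1)‖ := by
  simp only [terenziNorm]
  rw [max_eq_right h]
  ring

/-- The upper estimate for one step of the recursion. -/
lemma terenziNorm_succ_le (x : ∀ k, E k) (n : ℕ) :
    terenziNorm x (n + 1) ≤ terenziNorm x n + ‖x (n + 1)‖ := by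
  have h0 := terenziNorm_nonneg x n
  have h1 : max (‖x (n + 1)‖ / ((n : ℝ) + 2)) (terenziNorm x n) ≤
      ‖x (n + 1)‖ + terenziNorm x n := by
    refine max_le ?_ (by linarith [norm_nonneg (x (n + 1))])
    have : ‖x (n + 1)‖ / ((n : ℝ) + 2) ≤ ‖x (n + 1)‖ :=
      div_le_self (norm_nonneg _) (by linarith [n.cast_nonneg (α := ℝ)])
    linarith
  have h2 : 1 / ((n : ℝ) + 3) * max (‖x (n + 1)‖ / ((n : ℝ) + 2)) (terenziNorm x n) ≤
      1 / ((n : ℝ) + 3) * (‖x (n + 1)‖ + terenziNorm x n) := by gcongr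
  simp only [terenziNorm]
  linarith

lemma terenziNorm_monotone (x : ∀ k, E k) : Monotone (terenziNorm x) :=
  monotone_nat_of_le_succ fun n => by
    have := mul_nonneg (one_sub_one_div_add_three_pos n).le (norm_nonneg (x (n + 1)))
    linarith [terenziNorm_add_le_succ x n]

lemma terenziNorm_le_sum (x : ∀ k, E k) (n : ℕ) :
    terenziNorm x n ≤ ∑ j ∈ Finset.range (n + 1), ‖x j‖ := by
  induction n with
  | zero => simp [terenziNorm]
  | succ n ih =>
    rw [Finset.sum_range_succ]
    linarith [terenziNorm_succ_le x n]

lemma sum_le_terenziNorm (x : ∀ k, E k) (n : ℕ) :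
    2 / 3 * ∑ j ∈ Finset.range (n + 1), ‖x j‖ ≤ terenziNorm x n := by
  induction n with
  | zero => simp only [zero_add, Finset.sum_range_one, terenziNorm]; linarith [norm_nonneg (x 0)]
  | succ n ih =>
    rw [Finset.sum_range_succ]
    have h : (1 : ℝ) / ((n : ℝ) + 3) ≤ 1 / 3 := by gcongr; linarith [n.cast_nonneg (α := ℝ)]
    have : 2 / 3 * ‖x (n + 1)‖ ≤ (1 - 1 / ((n : ℝ) + 3)) * ‖x (n + 1)‖ := by
      gcongr; linarith
    linarith [terenziNorm_add_le_succ x n]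

lemma terenziNorm_congr {x y : ∀ k, E k} {n : ℕ} (h : ∀ j ≤ n, x j = y j) :
    terenziNorm x n = terenziNorm y n := by
  induction n with
  | zero => simp [terenziNorm, h 0 le_rfl]
  | succ n ih =>
    simp only [terenziNorm, h (n + 1) le_rfl, ih fun j hj => h j (hj.trans n.le_succ)]

lemma terenziNorm_zero (n : ℕ) : terenziNorm (0 : ∀ k, E k) n = 0 :=
  le_antisymm ((terenziNorm_le_sum _ n).trans (by simp)) (terenziNorm_nonneg _ n)

lemma terenziNorm_eq_of_forall_gt {x : ∀ k, E k} {k n : ℕ} (h : ∀ j, k < j → x j = 0)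
    (hn : k ≤ n) : terenziNorm x n = terenziNorm x k := by
  induction n, hn using Nat.le_induction with
  | base => rfl
  | succ n hn ih =>
    have h0 : x (n + 1) = 0 := h _ (by lia)
    rw [terenziNorm_succ_of_le (by simpa [h0] using terenziNorm_nonneg x n), ih]
    simp [h0]

lemma terenziNorm_neg (x : ∀ k, E k) (n : ℕ) : terenziNorm (-x) n = terenziNorm x n := by
  induction n with
  | zero => simp [terenziNorm]
  | succ n ih => simp [terenziNorm, ih]

lemma terenziNorm_smul [∀ k, NormedSpace ℝ (E k)] (c : ℝ) (x : ∀ k, E k) (n : ℕ) :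
    terenziNorm (c • x) n = |c| * terenziNorm x n := by
  induction n with
  | zero => simp [terenziNorm, norm_smul]
  | succ n ih =>
    simp only [terenziNorm, ih, Pi.smul_apply, norm_smul, Real.norm_eq_abs, mul_div_assoc,
      ← mul_max_of_nonneg _ _ (abs_nonneg c)]
    ring

/-- Subadditivity of the maximum that occurs in the recursion. -/
lemma max_terenziNorm_add_le {x y : ∀ k, E k} {n : ℕ}
    (h : terenziNorm (x + y) n ≤ terenziNorm x n + terenziNorm y n) :
    max (‖(x + y) (n + 1)‖ / ((n : ℝ) + 2)) (terenziNorm (x + y) n) ≤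
      max (‖x (n + 1)‖ / ((n : ℝ) + 2)) (terenziNorm x n) +
        max (‖y (n + 1)‖ / ((n : ℝ) + 2)) (terenziNorm y n) := by
  refine max_le ?_ (h.trans (add_le_add (le_max_right _ _) (le_max_right _ _)))
  refine le_trans ?_ (add_le_add (le_max_left _ _) (le_max_left _ _))
  rw [← add_div]
  gcongr
  exact norm_add_le _ _

lemma terenziNorm_add_le (x y : ∀ k, E k) (n : ℕ) :
    terenziNorm (x + y) n ≤ terenziNorm x n + terenziNorm y n := by
  induction n with
  | zero => exact norm_add_le _ _
  | succ n ih =>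
    have h1 := mul_le_mul_of_nonneg_left (add_le_add (norm_add_le (x (n + 1)) (y (n + 1))) ih)
      (one_sub_one_div_add_three_pos n).le
    have h2 := mul_le_mul_of_nonneg_left (max_terenziNorm_add_le ih)
      (show (0 : ℝ) ≤ 1 / ((n : ℝ) + 3) by positivity)
    simp only [terenziNorm]
    rw [Pi.add_apply] at h2 ⊢
    linarith

lemma terenziNorm_sub_le (x y : ∀ k, E k) (n : ℕ) :
    terenziNorm (x - y) n ≤ terenziNorm x n + terenziNorm y n := by
  simpa [sub_eq_add_neg, terenziNorm_neg] using terenziNorm_add_le x (-y) n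

lemma sub_le_terenziNorm_sub (x y : ∀ k, E k) (n : ℕ) :
    terenziNorm x n - terenziNorm y n ≤ terenziNorm (x - y) n := by
  have := terenziNorm_add_le (x - y) y n
  rw [sub_add_cancel] at this
  linarith

/-- Equality in the triangle inequality at one step of the recursion passes to the previous
step, to the last coordinates and to the maxima. -/
lemma terenziNorm_sub_eq_of_succ {x y : ∀ k, E k} {n : ℕ}
    (h : terenziNorm (x - y) (n + 1) = terenziNorm x (n + 1) + terenziNorm y (n + 1)) :
    terenziNorm (x - y) n = terenziNorm x n + terenziNorm y n ∧
      ‖x (n + 1) - y (n + 1)‖ = ‖x (n + 1)‖ + ‖y (n + 1)‖ ∧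
      max (‖x (n + 1) - y (n + 1)‖ / ((n : ℝ) + 2)) (terenziNorm (x - y) n) =
        max (‖x (n + 1)‖ / ((n : ℝ) + 2)) (terenziNorm x n) +
          max (‖y (n + 1)‖ / ((n : ℝ) + 2)) (terenziNorm y n) := by
  have h1 := norm_sub_le (x (n + 1)) (y (n + 1))
  have h2 := terenziNorm_sub_le x y n
  have h3 : max (‖x (n + 1) - y (n + 1)‖ / ((n : ℝ) + 2)) (terenziNorm (x - y) n) ≤
      max (‖x (n + 1)‖ / ((n : ℝ) + 2)) (terenziNorm x n) +
        max (‖y (n + 1)‖ / ((n : ℝ) + 2)) (terenziNorm y n) := by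
    simpa [sub_eq_add_neg, terenziNorm_neg] using
      max_terenziNorm_add_le (x := x) (y := -y) (terenziNorm_add_le x (-y) n)
  have hc := one_sub_one_div_add_three_pos n
  have hd : (0 : ℝ) < 1 / ((n : ℝ) + 3) := by positivity
  simp only [terenziNorm, Pi.sub_apply] at h
  have h1' := mul_le_mul_of_nonneg_left h1 hc.le
  have h2' := mul_le_mul_of_nonneg_left h2 hc.le
  have h3' := mul_le_mul_of_nonneg_left h3 hd.le
  refine ⟨mul_left_cancel₀ hc.ne' ?_, mul_left_cancel₀ hc.ne' ?_, mul_left_cancel₀ hd.ne' ?_⟩ <;>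
    linarith

/-- For a sequence `z` that is small up to `K`, the norm of `u - z` is nearly the sum of the
norms of `u` and `z`. -/
lemma add_le_terenziNorm_sub (u z : ∀ k, E k) {K n : ℕ} (hn : K ≤ n) :
    terenziNorm u n + terenziNorm z n ≤ terenziNorm (u - z) n + 2 * terenziNorm z K +
      2 * ∑ j ∈ Finset.Ioc K n, ‖u j‖ + 1 / ((K : ℝ) + 3) * ∑ j ∈ Finset.Ioc K n, ‖z j‖ := by
  induction n, hn using Nat.le_induction with
  | base => simp only [Finset.Ioc_self, Finset.sum_empty]; linarith [sub_le_terenziNorm_sub u z K]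
  | succ n hn ih =>
    rw [Finset.sum_Ioc_succ_top (by lia), Finset.sum_Ioc_succ_top (by lia)]
    have h1 := terenziNorm_add_le_succ (u - z) n
    have h2 := terenziNorm_succ_le u n
    have h3 := terenziNorm_succ_le z n
    have h4 : ‖z (n + 1)‖ - ‖u (n + 1)‖ ≤ ‖(u - z) (n + 1)‖ := by
      rw [Pi.sub_apply, norm_sub_rev]; exact norm_sub_norm_le _ _
    have h5 := mul_le_mul_of_nonneg_left h4 (one_sub_one_div_add_three_pos n).le
    have h6 : 1 / ((n : ℝ) + 3) * ‖z (n + 1)‖ ≤ 1 / ((K : ℝ) + 3) * ‖z (n + 1)‖ := by gcongr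
    have h7 : 0 ≤ 1 / ((n : ℝ) + 3) * ‖u (n + 1)‖ := by positivity
    linarith

end TerenziNorm

/-! ### The completion as a renorming of an `ℓ¹`-sum -/

section Limit

variable {E : ℕ → Type*} [∀ k, NormedAddCommGroup (E k)]

namespace lp

lemma summable_norm_one (x : lp E 1) : Summable fun k => ‖x k‖ := by
  simpa using (lp.memℓp x).summable (by simp)

lemma norm_one_eq_tsum (x : lp E 1) : ‖x‖ = ∑' k, ‖x k‖ := by
  simpa using lp.norm_eq_tsum_rpow (by simp) x

lemma sum_norm_le_norm_one (x : lp E 1) (s : Finset ℕ) : ∑ k ∈ s, ‖x k‖ ≤ ‖x‖ := by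
  rw [norm_one_eq_tsum]
  exact (summable_norm_one x).sum_le_tsum s fun _ _ => norm_nonneg _

end lp

/-- The limit of Terenzi's recursion along an absolutely summable sequence. The recursion is
monotone, so the limit is taken as a supremum. -/
noncomputable def terenziLimit (x : lp E 1) : ℝ := ⨆ n, terenziNorm (⇑x) n

lemma terenziNorm_le_norm (x : lp E 1) (n : ℕ) : terenziNorm (⇑x) n ≤ ‖x‖ :=
  (terenziNorm_le_sum _ n).trans (lp.sum_norm_le_norm_one x _)

lemma bddAbove_range_terenziNorm (x : lp E 1) :
    BddAbove (Set.range (terenziNorm (⇑x))) :=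
  ⟨‖x‖, Set.forall_mem_range.2 (terenziNorm_le_norm x)⟩

lemma tendsto_terenziNorm (x : lp E 1) :
    Tendsto (terenziNorm (⇑x)) atTop (𝓝 (terenziLimit x)) :=
  tendsto_atTop_ciSup (terenziNorm_monotone _) (bddAbove_range_terenziNorm x)

lemma terenziNorm_le_terenziLimit (x : lp E 1) (n : ℕ) : terenziNorm (⇑x) n ≤ terenziLimit x :=
  le_ciSup (bddAbove_range_terenziNorm x) n

lemma terenziLimit_nonneg (x : lp E 1) : 0 ≤ terenziLimit x :=
  (terenziNorm_nonneg _ 0).trans (terenziNorm_le_terenziLimit x 0)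

lemma terenziLimit_le_norm (x : lp E 1) : terenziLimit x ≤ ‖x‖ :=
  ciSup_le (terenziNorm_le_norm x)

lemma norm_le_terenziLimit (x : lp E 1) : 2 / 3 * ‖x‖ ≤ terenziLimit x := by
  rw [lp.norm_one_eq_tsum]
  exact le_of_tendsto_of_tendsto'
    (((lp.summable_norm_one x).hasSum.tendsto_sum_nat.comp (tendsto_add_atTop_nat 1)).const_mul _)
    (tendsto_terenziNorm x) (sum_le_terenziNorm _)

lemma terenziLimit_zero : terenziLimit (0 : lp E 1) = 0 :=
  le_antisymm (by simpa using terenziLimit_le_norm (0 : lp E 1)) (terenziLimit_nonneg _)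

lemma terenziLimit_neg (x : lp E 1) : terenziLimit (-x) = terenziLimit x :=
  congrArg iSup (funext (terenziNorm_neg (⇑x)))

lemma terenziLimit_add_le (x y : lp E 1) :
    terenziLimit (x + y) ≤ terenziLimit x + terenziLimit y :=
  ciSup_le fun n => (terenziNorm_add_le x y n).trans
    (add_le_add (terenziNorm_le_terenziLimit x n) (terenziNorm_le_terenziLimit y n))

lemma terenziLimit_sub_le (x y : lp E 1) :
    terenziLimit (x - y) ≤ terenziLimit x + terenziLimit y := by
  simpa [sub_eq_add_neg, terenziLimit_neg] using terenziLimit_add_le x (-y)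

lemma terenziLimit_eq_zero {x : lp E 1} (h : terenziLimit x = 0) : x = 0 := by
  have := norm_le_terenziLimit x
  exact norm_le_zero_iff.1 (by linarith)

lemma terenziLimit_smul [∀ k, NormedSpace ℝ (E k)] (c : ℝ) (x : lp E 1) :
    terenziLimit (c • x) = |c| * terenziLimit x := by
  refine tendsto_nhds_unique (tendsto_terenziNorm (c • x)) ?_
  have : terenziNorm (⇑(c • x)) = fun n => |c| * terenziNorm (⇑x) n :=
    funext fun n => terenziNorm_smul c (⇑x) n
  rw [this]
  exact (tendsto_terenziNorm x).const_mul _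

lemma terenziLimit_eq_of_forall_gt {x : lp E 1} {k : ℕ} (h : ∀ j, k < j → x j = 0) :
    terenziLimit x = terenziNorm (⇑x) k :=
  tendsto_nhds_unique (tendsto_terenziNorm x) <| tendsto_const_nhds.congr' <|
    (eventually_ge_atTop k).mono fun _ hn => (terenziNorm_eq_of_forall_gt h hn).symm

end Limit

/-- The `ℓ¹`-sum of the spaces `E k` as a vector space, to be normed by the limit of Terenzi's
recursion. This is a type synonym, so that the norm does not clash with that of `lp E 1`. -/
def TerenziSpace (E : ℕ → Type*) [∀ k, NormedAddCommGroup (E k)] : Type _ := lp E 1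

namespace TerenziSpace

variable (E : ℕ → Type*) [∀ k, NormedAddCommGroup (E k)]

noncomputable instance : AddCommGroup (TerenziSpace E) :=
  inferInstanceAs (AddCommGroup (lp E 1))

/-- The identity from the type synonym to `lp E 1`. -/
noncomputable def toLpAddEquiv : TerenziSpace E ≃+ lp E 1 := AddEquiv.refl _

noncomputable instance : NormedAddCommGroup (TerenziSpace E) :=
  AddGroupNorm.toNormedAddCommGroup
    { toFun := fun x => terenziLimit (toLpAddEquiv E x)
      map_zero' := terenziLimit_zero
      add_le' := fun x y => terenziLimit_add_le (toLpAddEquiv E x) (toLpAddEquiv E y)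
      neg' := fun x => terenziLimit_neg (toLpAddEquiv E x)
      eq_zero_of_map_eq_zero' := fun _ h => (toLpAddEquiv E).map_eq_zero_iff.1
        (terenziLimit_eq_zero h) }

lemma norm_eq (x : TerenziSpace E) : ‖x‖ = terenziLimit (toLpAddEquiv E x) := rfl

variable [∀ k, NormedSpace ℝ (E k)]

noncomputable instance : Module ℝ (TerenziSpace E) := inferInstanceAs (Module ℝ (lp E 1))

noncomputable instance : NormedSpace ℝ (TerenziSpace E) where
  norm_smul_le c x := (terenziLimit_smul c (toLpAddEquiv E x)).le

/-- The identity from the type synonym to `lp E 1`, as a linear homeomorphism. -/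
noncomputable def equivLp : TerenziSpace E ≃L[ℝ] lp E 1 :=
  LinearEquiv.toContinuousLinearEquivOfBounds
    { toLpAddEquiv E with map_smul' := fun _ _ => rfl } (3 / 2) 1
    (fun x => by
      have := norm_le_terenziLimit (toLpAddEquiv E x)
      rw [norm_eq]
      change ‖toLpAddEquiv E x‖ ≤ _
      linarith)
    (fun x => by
      rw [norm_eq, one_mul]
      exact terenziLimit_le_norm x)

lemma norm_eq_terenziLimit (x : TerenziSpace E) : ‖x‖ = terenziLimit (equivLp E x) := rfl

lemma norm_equivLp_symm (x : lp E 1) : ‖(equivLp E).symm x‖ = terenziLimit x := rfl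

instance [∀ k, CompleteSpace (E k)] : CompleteSpace (TerenziSpace E) :=
  (completeSpace_congr (e := (equivLp E).toEquiv) (equivLp E).isUniformEmbedding).2 inferInstance

/-- A finitely supported sequence is absolutely summable. -/
def dfinsuppToLp : (Π₀ k, E k) →ₗ[ℝ] lp E 1 where
  toFun x := ⟨⇑x, memℓp_gen (p := 1) <| by
    simpa using summable_of_ne_finset_zero (s := (DFinsupp.finite_support x).toFinset) <| by
      simp⟩
  map_add' _ _ := rfl
  map_smul' _ _ := rfl

lemma dfinsuppToLp_single (k : ℕ) (a : E k) :
    dfinsuppToLp E (DFinsupp.single k a) = lp.single 1 k a := by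
  ext j
  change DFinsupp.single k a j = _
  rw [lp.single_apply, DFinsupp.single_eq_pi_single]

theorem isTerenziSum [∀ k, CompleteSpace (E k)] : IsTerenziSum E (TerenziSpace E) := by
  refine ⟨inferInstance, (equivLp E).symm.toLinearMap ∘ₗ dfinsuppToLp E, ?_, fun x k hx => ?_⟩
  · refine (equivLp E).symm.surjective.denseRange.comp (f := dfinsuppToLp E) (fun x => ?_)
      (equivLp E).symm.continuous
    refine mem_closure_of_tendsto (lp.hasSum_single ENNReal.one_ne_top x)
      (Eventually.of_forall fun s => ⟨∑ i ∈ s, DFinsupp.single i (x i), ?_⟩)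
    simp [map_sum, dfinsuppToLp_single]
  · exact terenziLimit_eq_of_forall_gt (x := dfinsuppToLp E x) hx

end TerenziSpace

/-! ### Absence of equilateral sequences -/

section Equilateral

variable {E : ℕ → Type*} [∀ k, NormedAddCommGroup (E k)]

/-- The term of a nonzero vector that competes with the norm of the initial part is eventually
the smaller one. -/
lemma eventually_norm_div_lt_terenziNorm {u : lp E 1} (hu : u ≠ 0) :
    ∀ᶠ n : ℕ in atTop, ‖u (n + 1)‖ / ((n : ℝ) + 2) < terenziNorm (⇑u) n := by
  have hpos : 0 < terenziLimit u :=
    (terenziLimit_nonneg u).lt_of_ne fun h => hu (terenziLimit_eq_zero h.symm)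
  have h0 : Tendsto (fun n : ℕ => ‖u (n + 1)‖) atTop (𝓝 0) :=
    (lp.summable_norm_one u).tendsto_atTop_zero.comp (tendsto_add_atTop_nat 1)
  filter_upwards [h0.eventually_lt_const (half_pos hpos),
    (tendsto_terenziNorm u).eventually_const_lt (half_lt_self hpos)] with n h1 h2
  exact (div_le_self (norm_nonneg _) (by linarith [n.cast_nonneg (α := ℝ)])).trans_lt
    (h1.trans h2)

/-- Adding a fixed vector `u` to vectors `z m` that tend to `0` coordinatewise asymptotically
adds up the norms: the norm behaves like that of an `ℓ¹`-sum at infinity. -/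
lemma eventually_add_le_terenziLimit_sub (u : lp E 1) {z : ℕ → lp E 1} {M : ℝ}
    (hM : ∀ m, ‖z m‖ ≤ M) (hz : ∀ j, Tendsto (fun m => z m j) atTop (𝓝 0)) {ε : ℝ} (hε : 0 < ε) :
    ∀ᶠ m in atTop, terenziLimit u + terenziLimit (z m) ≤ terenziLimit (u - z m) + ε := by
  have hd : Tendsto (fun K : ℕ => M * (1 / ((K : ℝ) + 3))) atTop (𝓝 0) := by
    have : Tendsto (fun K : ℕ => (1 : ℝ) / ((K : ℝ) + 3)) atTop (𝓝 0) := by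
      have h := (tendsto_const_div_atTop_nhds_zero_nat (1 : ℝ)).comp (tendsto_add_atTop_nat 3)
      refine h.congr fun K => ?_
      simp
    simpa using this.const_mul M
  have htail : Tendsto (fun K : ℕ => ‖u‖ - ∑ j ∈ Finset.range (K + 1), ‖u j‖) atTop (𝓝 0) := by
    have h := (lp.summable_norm_one u).hasSum.tendsto_sum_nat.comp (tendsto_add_atTop_nat 1)
    rw [← lp.norm_one_eq_tsum] at h
    simpa using h.const_sub ‖u‖
  obtain ⟨K, hK1, hK2⟩ := ((hd.eventually_lt_const (show 0 < ε / 3 by positivity)).and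
    (htail.eventually_lt_const (show 0 < ε / 6 by positivity))).exists
  have hhead : Tendsto (fun m => terenziNorm (⇑(z m)) K) atTop (𝓝 0) := by
    refine squeeze_zero (fun m => terenziNorm_nonneg _ _) (fun m => terenziNorm_le_sum _ _) ?_
    simpa using tendsto_finsetSum (Finset.range (K + 1)) fun j _ => (hz j).norm
  filter_upwards [hhead.eventually_lt_const (show 0 < ε / 6 by positivity)] with m hm
  refine le_of_tendsto_of_tendsto ((tendsto_terenziNorm u).add (tendsto_terenziNorm (z m)))
    ((tendsto_terenziNorm (u - z m)).add_const ε) ?_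
  filter_upwards [eventually_ge_atTop K] with n hn
  have h1 := add_le_terenziNorm_sub (⇑u) (⇑(z m)) hn
  have h2 : ∑ j ∈ Finset.Ioc K n, ‖u j‖ ≤ ‖u‖ - ∑ j ∈ Finset.range (K + 1), ‖u j‖ := by
    have h3 : Disjoint (Finset.range (K + 1)) (Finset.Ioc K n) :=
      Finset.disjoint_left.2 fun j hj hj' => by
        simp only [Finset.mem_range, Finset.mem_Ioc] at hj hj'; lia
    have h4 := lp.sum_norm_le_norm_one u (Finset.range (K + 1) ∪ Finset.Ioc K n)
    rw [Finset.sum_union h3] at h4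
    linarith
  have h5 : 1 / ((K : ℝ) + 3) * ∑ j ∈ Finset.Ioc K n, ‖z m j‖ ≤ M * (1 / ((K : ℝ) + 3)) := by
    rw [mul_comm M]
    gcongr
    exact (lp.sum_norm_le_norm_one (z m) _).trans (hM m)
  rw [lp.coeFn_sub]
  linarith

/-- Equality in the triangle inequality is inherited by all stages of the recursion. A defect at
one stage persists at all later ones, and it can no longer shrink once the maximum in the
recursion for `u - v` is attained at the norm of the initial part. -/
lemma terenziNorm_sub_eq_of_terenziLimit_sub_eq {u v : lp E 1} (huv : u ≠ v)
    (h : terenziLimit (u - v) = terenziLimit u + terenziLimit v) (n : ℕ) :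
    terenziNorm (⇑u - ⇑v) n = terenziNorm (⇑u) n + terenziNorm (⇑v) n := by
  by_contra hne
  obtain ⟨N, hN⟩ := eventually_atTop.1 (eventually_norm_div_lt_terenziNorm (sub_ne_zero.2 huv))
  simp only [lp.coeFn_sub] at hN
  have hpersist : ∀ m, n ≤ m →
      terenziNorm (⇑u - ⇑v) m ≠ terenziNorm (⇑u) m + terenziNorm (⇑v) m := fun m hm => by
    induction m, hm using Nat.le_induction with
    | base => exact hne
    | succ m _ ih => exact fun h' => ih (terenziNorm_sub_eq_of_succ h').1
  set gap : ℕ → ℝ := fun m =>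
    terenziNorm (⇑u) m + terenziNorm (⇑v) m - terenziNorm (⇑u - ⇑v) m with hgap
  have hlim : Tendsto gap atTop (𝓝 0) := by
    have := ((tendsto_terenziNorm u).add (tendsto_terenziNorm v)).sub (tendsto_terenziNorm (u - v))
    rwa [h, sub_self] at this
  have hmono : ∀ m, max n N ≤ m → gap (max n N) ≤ gap m := fun m hm => by
    induction m, hm using Nat.le_induction with
    | base => exact le_rfl
    | succ m hm ih =>
      refine ih.trans ?_
      have h1 := terenziNorm_succ_of_le (hN m ((le_max_right _ _).trans hm)).le
      have h2 := terenziNorm_add_le_succ (⇑u) m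
      have h3 := terenziNorm_add_le_succ (⇑v) m
      have h4 := mul_le_mul_of_nonneg_left (norm_sub_le (u (m + 1)) (v (m + 1)))
        (one_sub_one_div_add_three_pos m).le
      simp only [Pi.sub_apply] at h1
      simp only [hgap]
      linarith
  have hle : gap (max n N) ≤ 0 := ge_of_tendsto hlim (eventually_atTop.2 ⟨_, hmono⟩)
  refine hpersist _ (le_max_left n N) (le_antisymm (terenziNorm_sub_le _ _ _) ?_)
  simp only [hgap] at hle
  linarith

/-- In a strictly convex space, equality in `‖x - y‖ ≤ ‖x‖ + ‖y‖` means that `x` and `y` are on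
opposite rays; three nonzero vectors cannot be pairwise so. -/
lemma eq_zero_of_norm_sub_eq_add {F : Type*} [NormedAddCommGroup F] [NormedSpace ℝ F]
    [StrictConvexSpace ℝ F] {a b c : F} (hab : ‖a - b‖ = ‖a‖ + ‖b‖) (hac : ‖a - c‖ = ‖a‖ + ‖c‖)
    (hbc : ‖b - c‖ = ‖b‖ + ‖c‖) (ha : a ≠ 0) (hb : b ≠ 0) : c = 0 := by
  by_contra hc
  have key : ∀ {x y : F}, ‖x - y‖ = ‖x‖ + ‖y‖ → SameRay ℝ x (-y) := fun {x y} h =>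
    sameRay_iff_norm_add.2 (by rwa [← sub_eq_add_neg, norm_neg])
  have h1 : SameRay ℝ a b := (key hac).trans (key hbc).symm fun h => absurd (neg_eq_zero.1 h) hc
  have h2 : SameRay ℝ a (-a) :=
    (key hab).trans h1.symm.neg fun h => absurd (neg_eq_zero.1 h) hb
  have h3 : a = -a :=
    eq_of_norm_eq_of_norm_add_eq (norm_neg a).symm (sameRay_iff_norm_add.1 h2)
  exact ha ((smul_eq_zero.1 ((two_smul ℝ a).trans (add_eq_zero_iff_eq_neg.2 h3))).resolve_left
    two_ne_zero)

/-- The triangle inequality cannot be an equality for the differences of all pairs from an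
infinite sequence. Strict convexity would leave at most two members nonzero at each coordinate, so
some member `z k` starts arbitrarily far out; but at the first nonzero coordinate of such a `z k`
the maximum in the recursion for `z m - z k` is strictly less than the sum of those for `z m` and
`z k`. -/
lemma not_forall_terenziLimit_sub_eq_add [∀ k, NormedSpace ℝ (E k)]
    [∀ k, StrictConvexSpace ℝ (E k)] {z : ℕ → lp E 1} (hz : Function.Injective z)
    (h : ∀ m k, m ≠ k → terenziLimit (z m - z k) = terenziLimit (z m) + terenziLimit (z k)) :
    False := by
  have hT : ∀ m k, m ≠ k → ∀ n,
      terenziNorm (⇑(z m) - ⇑(z k)) n = terenziNorm (⇑(z m)) n + terenziNorm (⇑(z k)) n :=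
    fun m k hmk => terenziNorm_sub_eq_of_terenziLimit_sub_eq (hz.ne hmk) (h m k hmk)
  have hnorm : ∀ n m k, m ≠ k → ‖z m n - z k n‖ = ‖z m n‖ + ‖z k n‖ := fun n m k hmk => by
    cases n with
    | zero => exact hT m k hmk 0
    | succ n => exact (terenziNorm_sub_eq_of_succ (hT m k hmk (n + 1))).2.1
  have hcoord : ∀ n, ∀ᶠ m in atTop, z m n = 0 := fun n => by
    by_contra hf
    rw [not_eventually] at hf
    obtain ⟨a, -, ha⟩ := frequently_atTop.1 hf 0
    obtain ⟨b, hab, hb⟩ := frequently_atTop.1 hf (a + 1)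
    obtain ⟨c, hbc, hc⟩ := frequently_atTop.1 hf (b + 1)
    exact hc (eq_zero_of_norm_sub_eq_add (hnorm n a b (by lia)) (hnorm n a c (by lia))
      (hnorm n b c (by lia)) ha hb)
  have hne : ∀ᶠ m in atTop, z m ≠ 0 := by
    by_cases h0 : ∃ m, z m = 0
    · obtain ⟨m, hm⟩ := h0
      exact (eventually_gt_atTop m).mono fun k hk h' => hk.ne (hz (hm.trans h'.symm))
    · exact Eventually.of_forall (not_exists.1 h0)
  obtain ⟨m, hm⟩ := hne.exists
  obtain ⟨N, hN⟩ := eventually_atTop.1 (eventually_norm_div_lt_terenziNorm hm)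
  -- a second vector, whose first nonzero coordinate `n + 1` satisfies `N ≤ n`
  obtain ⟨k, hkm, hk0, hkN⟩ := ((eventually_gt_atTop m).and (hne.and
    ((eventually_all_finset (Finset.range (N + 1))).2 fun n _ => hcoord n))).exists
  have hex : ∃ j, z k j ≠ 0 := by
    by_contra! h'
    exact hk0 (lp.ext (funext h'))
  classical
  obtain ⟨n, hn⟩ : ∃ n, Nat.find hex = n + 1 := by
    refine Nat.exists_eq_succ_of_ne_zero fun h0 => Nat.find_spec hex ?_
    rw [h0]
    exact hkN 0 (by simp)
  have hn1 : z k (n + 1) ≠ 0 := hn ▸ Nat.find_spec hex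
  have hn0 : ∀ j ≤ n, z k j = 0 := fun j hj =>
    not_not.1 (Nat.find_min hex (m := j) (by lia))
  have hNn : N ≤ n := by
    by_contra hlt
    exact hn1 (hkN (n + 1) (Finset.mem_range.2 (by lia)))
  have hk : terenziNorm (⇑(z k)) n = 0 := by
    rw [terenziNorm_congr (y := 0) hn0, terenziNorm_zero]
  have hpos : 0 < ‖z k (n + 1)‖ / ((n : ℝ) + 2) := by positivity
  have hmax := (terenziNorm_sub_eq_of_succ (hT m k hkm.ne (n + 1))).2.2
  have hlt := hN n hNn
  rw [hT m k hkm.ne n, hnorm (n + 1) m k hkm.ne, hk, max_eq_right hlt.le, max_eq_left hpos.le,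
    add_zero, add_div] at hmax
  exact absurd hmax (max_lt (by linarith) (by linarith)).ne

theorem TerenziSpace.not_hasEquilateralSequence [∀ k, NormedSpace ℝ (E k)]
    [∀ k, StrictConvexSpace ℝ (E k)] [∀ k, ProperSpace (E k)] :
    ¬ HasEquilateralSequence (TerenziSpace E) := by
  rintro ⟨x', hinj, r, -, hr⟩
  set x : ℕ → lp E 1 := fun m => equivLp E (x' m) with hx
  have hxinj : Function.Injective x := (equivLp E).injective.comp hinj
  have hxr : ∀ m k, m ≠ k → terenziLimit (x m - x k) = r := fun m k hmk => by
    rw [← hr _ ⟨m, rfl⟩ _ ⟨k, rfl⟩ (hinj.ne hmk), norm_eq_terenziLimit, map_sub]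
  have hr0 : 0 ≤ r := (terenziLimit_nonneg _).trans_eq (hxr 0 1 (by simp))
  have hdist : ∀ m k, ‖x m - x k‖ ≤ 3 / 2 * r := fun m k => by
    rcases eq_or_ne m k with rfl | hmk
    · simpa using hr0
    · linarith [norm_le_terenziLimit (x m - x k), hxr m k hmk]
  have hbdd : ∀ m, ‖x m‖ ≤ 3 / 2 * r + ‖x 0‖ := fun m => by
    have := norm_sub_norm_le (x m) (x 0)
    linarith [hdist m 0]
  -- a subsequence that converges coordinatewise, to a limit in the space
  obtain ⟨y, -, φ, hφ, hlim⟩ :=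
    (isCompact_univ_pi fun j => isCompact_closedBall (0 : E j) (3 / 2 * r + ‖x 0‖)).tendsto_subseq
      (x := fun m => ⇑(x m)) fun m j _ => mem_closedBall_zero_iff.2
        ((lp.norm_apply_le_norm one_ne_zero (x m) j).trans (hbdd m))
  have hy : Memℓp y 1 := lp.memℓp_of_tendsto (F := fun m => x (φ m))
    (isBounded_iff_forall_norm_le.2 ⟨_, Set.forall_mem_range.2 fun m => hbdd (φ m)⟩) hlim
  -- a further subsequence along which the distances to the limit converge
  obtain ⟨L, -, ψ, hψ, hL⟩ := tendsto_subseq_of_bounded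
    (x := fun m => terenziLimit (x (φ m) - ⟨y, hy⟩))
    (Metric.isBounded_Icc 0 (3 / 2 * r + ‖x 0‖ + ‖(⟨y, hy⟩ : lp E 1)‖)) fun m =>
      ⟨terenziLimit_nonneg _, (terenziLimit_le_norm _).trans ((norm_sub_le _ _).trans
        (by linarith [hbdd (φ m)]))⟩
  set z : ℕ → lp E 1 := fun m => x (φ (ψ m)) - ⟨y, hy⟩ with hz
  have hzM : ∀ m, ‖z m‖ ≤ 3 / 2 * r + ‖x 0‖ + ‖(⟨y, hy⟩ : lp E 1)‖ := fun m =>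
    (norm_sub_le _ _).trans (by linarith [hbdd (φ (ψ m))])
  have hz0 : ∀ j, Tendsto (fun m => z m j) atTop (𝓝 0) := fun j => by
    have h1 : Tendsto (fun m => x (φ (ψ m)) j) atTop (𝓝 (y j)) :=
      ((tendsto_pi_nhds.1 hlim) j).comp hψ.tendsto_atTop
    rw [← sub_self (y j)]
    exact h1.sub_const (y j)
  have hzinj : Function.Injective z := fun m k h =>
    (hφ.comp hψ).injective (hxinj (sub_left_injective h))
  have hzr : ∀ m k, m ≠ k → terenziLimit (z m - z k) = r := fun m k hmk => by
    rw [← hxr (φ (ψ m)) (φ (ψ k)) ((hφ.comp hψ).injective.ne hmk)]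
    simp only [hz, sub_sub_sub_cancel_right]
  -- comparing `z m` with `z k`, `k → ∞`, determines the norms: all of them are `r / 2`
  replace hL : Tendsto (fun m => terenziLimit (z m)) atTop (𝓝 L) := hL
  have hzL : ∀ m, terenziLimit (z m) = r - L := fun m => by
    apply le_antisymm
    · refine le_of_forall_pos_le_add fun ε hε => ?_
      have h1 : terenziLimit (z m) + L ≤ r + ε := by
        refine le_of_tendsto (hL.const_add _) ?_
        filter_upwards [eventually_add_le_terenziLimit_sub (z m) hzM hz0 hε,
          eventually_gt_atTop m] with k hk hmk
        rwa [hzr m k hmk.ne] at hk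
      linarith
    · have h1 : r ≤ terenziLimit (z m) + L := by
        refine ge_of_tendsto (hL.const_add _) ?_
        filter_upwards [eventually_gt_atTop m] with k hmk
        rw [← hzr m k hmk.ne]
        exact terenziLimit_sub_le _ _
      linarith
  have hLr : L = r - L := tendsto_nhds_unique hL (by simp only [hzL]; exact tendsto_const_nhds)
  exact not_forall_terenziLimit_sub_eq_add hzinj fun m k hmk => by
    rw [hzr m k hmk, hzL, hzL]
    linarith

end Equilateral

/-! ### Strict convexity of `ℓᵖ` -/

theorem PiLp.strictConvexSpace {ι : Type*} [Fintype ι] (p : ℝ≥0∞) [Fact (1 ≤ p)] (hp : 1 < p)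
    (hp_top : p ≠ ⊤) : StrictConvexSpace ℝ (PiLp p fun _ : ι => ℝ) := by
  have hp1 : 1 < p.toReal := by
    rwa [← ENNReal.toReal_one, ENNReal.toReal_lt_toReal ENNReal.one_ne_top hp_top]
  have hp0 : 0 < p.toReal := by linarith
  have hnorm : ∀ x : PiLp p fun _ : ι => ℝ, ‖x‖ = 1 ↔ ∑ i, |x i| ^ p.toReal = 1 := fun x => by
    rw [PiLp.norm_eq_sum hp0, one_div, Real.rpow_inv_eq (by positivity) zero_le_one hp0.ne',
      Real.one_rpow]
    simp only [Real.norm_eq_abs]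
  have hsc : StrictConvexOn ℝ (Set.Ici 0) fun t : ℝ => t ^ p.toReal := strictConvexOn_rpow hp1
  -- the convexity of `t ↦ |t| ^ p` at the midpoint
  have hle : ∀ a b : ℝ, |1 / 2 * (a + b)| ^ p.toReal ≤
      1 / 2 * |a| ^ p.toReal + 1 / 2 * |b| ^ p.toReal := fun a b => by
    have h := hsc.convexOn.2 (Set.mem_Ici.2 (abs_nonneg a)) (Set.mem_Ici.2 (abs_nonneg b))
      (by norm_num : (0 : ℝ) ≤ 1 / 2) (by norm_num : (0 : ℝ) ≤ 1 / 2) (by norm_num)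
    simp only [smul_eq_mul] at h
    refine le_trans (Real.rpow_le_rpow (abs_nonneg _) ?_ hp0.le) h
    rw [abs_mul, abs_of_pos (by norm_num : (0 : ℝ) < 1 / 2)]
    linarith [abs_add_le a b]
  have hlt : ∀ a b : ℝ, a ≠ b → |1 / 2 * (a + b)| ^ p.toReal <
      1 / 2 * |a| ^ p.toReal + 1 / 2 * |b| ^ p.toReal := fun a b hab => by
    by_cases h : |a| = |b|
    · -- here `b = -a`, and the left-hand side vanishes
      obtain rfl : b = -a := by
        rcases abs_eq_abs.1 h with h | h
        · exact absurd h hab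
        · linarith
      have ha : a ≠ 0 := by rintro rfl; simp at hab
      have : 0 < |a| ^ p.toReal := Real.rpow_pos_of_pos (abs_pos.2 ha) _
      simp only [add_neg_cancel, mul_zero, abs_zero, Real.zero_rpow hp0.ne', abs_neg]
      linarith
    · have h' := hsc.2 (Set.mem_Ici.2 (abs_nonneg a)) (Set.mem_Ici.2 (abs_nonneg b)) h
        (by norm_num : (0 : ℝ) < 1 / 2) (by norm_num : (0 : ℝ) < 1 / 2) (by norm_num)
      simp only [smul_eq_mul] at h'
      refine lt_of_le_of_lt (Real.rpow_le_rpow (abs_nonneg _) ?_ hp0.le) h'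
      rw [abs_mul, abs_of_pos (by norm_num : (0 : ℝ) < 1 / 2)]
      linarith [abs_add_le a b]
  refine StrictConvexSpace.of_norm_add_ne_two fun x y hx hy hxy h => ?_
  obtain ⟨j, hj⟩ : ∃ j, x j ≠ y j := by
    by_contra! h'
    exact hxy (PiLp.ext h')
  have h1 : ‖(1 / 2 : ℝ) • (x + y)‖ = 1 := by rw [norm_smul, h]; norm_num
  rw [hnorm] at h1 hx hy
  have h2 : ∑ i, |1 / 2 * (x i + y i)| ^ p.toReal <
      ∑ i, (1 / 2 * |x i| ^ p.toReal + 1 / 2 * |y i| ^ p.toReal) :=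
    Finset.sum_lt_sum (fun i _ => hle _ _) ⟨j, Finset.mem_univ j, hlt _ _ hj⟩
  rw [Finset.sum_add_distrib, ← Finset.mul_sum, ← Finset.mul_sum, hx, hy] at h2
  simp only [PiLp.smul_apply, PiLp.add_apply, smul_eq_mul] at h1
  linarith

/-! ### The unconditional basis -/

theorem PiLp.norm_le_norm_of_forall_norm_le {ι : Type*} [Fintype ι] {p : ℝ≥0∞} [Fact (1 ≤ p)]
    (hp_top : p ≠ ⊤) {x y : PiLp p fun _ : ι => ℝ} (h : ∀ i, ‖x i‖ ≤ ‖y i‖) : ‖x‖ ≤ ‖y‖ := by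
  have hp : 0 < p.toReal := ENNReal.toReal_pos (zero_lt_one.trans_le Fact.out).ne' hp_top
  rw [PiLp.norm_eq_sum hp, PiLp.norm_eq_sum hp]
  gcongr with i
  exact h i

section Basis

variable (p : ℝ≥0∞) [Fact (1 ≤ p)] {κ : ℕ → Type*} [∀ k, Fintype (κ k)]

/-- The unit vectors of the `ℓ¹`-sum of finite-dimensional `ℓᵖ`-spaces. -/
noncomputable def lpUnitVec [∀ k, DecidableEq (κ k)] (s : Σ k, κ k) :
    lp (fun k => PiLp p fun _ : κ k => ℝ) 1 :=
  lp.single 1 s.1 (PiLp.single p s.2 (1 : ℝ))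

/-- The coordinate functionals of the `ℓ¹`-sum of finite-dimensional `ℓᵖ`-spaces. -/
noncomputable def lpCoord (s : Σ k, κ k) :
    lp (fun k => PiLp p fun _ : κ k => ℝ) 1 →L[ℝ] ℝ :=
  LinearMap.mkContinuous
    { toFun := fun x => x s.1 s.2
      map_add' := fun _ _ => rfl
      map_smul' := fun _ _ => rfl } 1 fun x => by
    rw [one_mul]
    exact (PiLp.norm_apply_le _ _).trans (lp.norm_apply_le_norm one_ne_zero x s.1)

lemma lpCoord_apply (s : Σ k, κ k) (x : lp (fun k => PiLp p fun _ : κ k => ℝ) 1) :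
    lpCoord p s x = x s.1 s.2 := rfl

lemma lpUnitVec_apply [∀ k, DecidableEq (κ k)] (s t : Σ k, κ k) :
    lpUnitVec p s t.1 t.2 = if t = s then 1 else 0 := by
  obtain ⟨k, i⟩ := s
  obtain ⟨l, j⟩ := t
  rw [lpUnitVec, lp.single_apply]
  rcases eq_or_ne l k with rfl | h
  · simp
  · simp [h]

lemma sum_smul_lpUnitVec_apply [∀ k, DecidableEq (κ k)] (c : (Σ k, κ k) → ℝ)
    (A : Finset (Σ k, κ k)) (k : ℕ) (i : κ k) :
    (∑ s ∈ A, c s • lpUnitVec p s) k i = if ⟨k, i⟩ ∈ A then c ⟨k, i⟩ else 0 := by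
  have h : ∀ x : lp (fun k => PiLp p fun _ : κ k => ℝ) 1, x k i = lpCoord p ⟨k, i⟩ x :=
    fun _ => rfl
  rw [h, map_sum]
  simp [lpCoord_apply, lpUnitVec_apply p _ ⟨k, i⟩]

/-- A partial sum that contains the coordinates of the first blocks is at least as close to `x`
as the sum of these blocks. -/
lemma hasSum_lpCoord_smul_lpUnitVec [∀ k, DecidableEq (κ k)] (hp_top : p ≠ ⊤)
    (x : lp (fun k => PiLp p fun _ : κ k => ℝ) 1) :
    HasSum (fun s => lpCoord p s x • lpUnitVec p s) x := by
  have h := lp.hasSum_single ENNReal.one_ne_top x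
  rw [HasSum, Metric.tendsto_nhds] at h ⊢
  intro ε hε
  simp only [SummationFilter.unconditional_filter, eventually_atTop] at h ⊢
  obtain ⟨s₀, hs₀⟩ := h ε hε
  refine ⟨s₀.sigma fun _ => Finset.univ, fun A hA => lt_of_le_of_lt ?_ (hs₀ s₀ le_rfl)⟩
  rw [dist_eq_norm, dist_eq_norm]
  refine lp.norm_mono one_ne_zero fun k => ?_
  refine PiLp.norm_le_norm_of_forall_norm_le hp_top fun i => ?_
  have h1 : (∑ k ∈ s₀, lp.single 1 k (x k) - x) k i = (if k ∈ s₀ then x k i else 0) - x k i := by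
    have h2 : (∑ j ∈ s₀, lp.single 1 j (x j)) k i =
        lpCoord p ⟨k, i⟩ (∑ j ∈ s₀, lp.single 1 j (x j)) := rfl
    rw [lp.coeFn_sub, Pi.sub_apply, PiLp.sub_apply, h2, map_sum]
    congr 1
    have h3 : ∀ j, lpCoord p ⟨k, i⟩ (lp.single 1 j (x j)) = if j = k then x k i else 0 := by
      intro j
      rw [lpCoord_apply, lp.single_apply]
      rcases eq_or_ne k j with rfl | hkj
      · simp
      · simp [hkj, hkj.symm]
    simp only [h3, Finset.sum_ite_eq']
  rw [lp.coeFn_sub, Pi.sub_apply, PiLp.sub_apply, sum_smul_lpUnitVec_apply, h1, lpCoord_apply]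
  by_cases hk : k ∈ s₀
  · rw [if_pos (hA (by simp [hk])), if_pos hk]
  · rw [if_neg hk]
    split_ifs <;> simp

/-- The unit vectors of the `ℓ¹`-sum of finite-dimensional `ℓᵖ`-spaces as an unconditional
basis. -/
noncomputable def lpUnconditionalBasis [∀ k, DecidableEq (κ k)] (hp_top : p ≠ ⊤) :
    UnconditionalSchauderBasis (Σ k, κ k) ℝ (lp (fun k => PiLp p fun _ : κ k => ℝ) 1) where
  basis := lpUnitVec p
  coord := lpCoord p
  ortho s t := by
    rw [lpCoord_apply, lpUnitVec_apply]
    rcases eq_or_ne s t with rfl | h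
    · simp
    · simp [h]
  expansion := hasSum_lpCoord_smul_lpUnitVec p hp_top

end Basis

/-- The image of an unconditional basis under a linear homeomorphism. -/
noncomputable def UnconditionalSchauderBasis.map {β X Y : Type*} [NormedAddCommGroup X]
    [NormedSpace ℝ X] [NormedAddCommGroup Y] [NormedSpace ℝ Y]
    (b : UnconditionalSchauderBasis β ℝ X) (e : X ≃L[ℝ] Y) : UnconditionalSchauderBasis β ℝ Y where
  basis i := e (b i)
  coord i := (b.coord i).comp (e.symm : Y →L[ℝ] X)
  ortho i j := by simpa using b.ortho i j
  expansion y := by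
    have := (b.expansion (e.symm y)).mapL (e : X →L[ℝ] Y)
    simpa using this

/-- An unconditional basis reindexed along a bijection. -/
noncomputable def UnconditionalSchauderBasis.reindex {β γ X : Type*} [NormedAddCommGroup X]
    [NormedSpace ℝ X] (b : UnconditionalSchauderBasis β ℝ X) (e : γ ≃ β) :
    UnconditionalSchauderBasis γ ℝ X where
  basis i := b (e i)
  coord i := b.coord (e i)
  ortho i j := by
    rw [b.ortho]
    rcases eq_or_ne i j with rfl | h
    · simp
    · simp [h]
  expansion x := e.hasSum_iff.2 (b.expansion x)

theorem UnconditionalSchauderBasis.separableSpace {β X : Type*} [Countable β]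
    [NormedAddCommGroup X] [NormedSpace ℝ X] (b : UnconditionalSchauderBasis β ℝ X) :
    TopologicalSpace.SeparableSpace X := by
  rw [← TopologicalSpace.isSeparable_univ_iff]
  refine ((Set.countable_range b).isSeparable.span (R := ℝ)).closure.mono fun x _ => ?_
  refine mem_closure_of_tendsto (b.expansion x) (Eventually.of_forall fun A => ?_)
  exact Submodule.sum_mem _ fun i _ => Submodule.smul_mem _ _ (Submodule.subset_span ⟨i, rfl⟩)

/-! ### Random signs in `ℓ¹` -/

lemma sum_units_fin_succ {n : ℕ} (F : (Fin (n + 1) → ℤˣ) → ℝ) :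
    ∑ ε, F ε = ∑ ε : Fin n → ℤˣ, (F (Fin.cons 1 ε) + F (Fin.cons (-1) ε)) := by
  rw [← (Fin.consEquiv fun _ : Fin (n + 1) => ℤˣ).sum_comp, Fintype.sum_prod_type,
    UnitsInt.univ, Finset.sum_pair (by decide), ← Finset.sum_add_distrib]
  rfl

/-- The second moment of a Rademacher sum. -/
lemma sum_units_sq (n : ℕ) (a : Fin n → ℝ) :
    ∑ ε : Fin n → ℤˣ, (∑ i, ((ε i : ℤ) : ℝ) * a i) ^ 2 = 2 ^ n * ∑ i, a i ^ 2 := by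
  induction n with
  | zero => simp
  | succ n ih =>
    rw [sum_units_fin_succ]
    simp only [Fin.sum_univ_succ, Fin.cons_zero, Fin.cons_succ]
    have h : ∀ ε : Fin n → ℤˣ,
        ((((1 : ℤˣ) : ℤ) : ℝ) * a 0 + ∑ i, ((ε i : ℤ) : ℝ) * a i.succ) ^ 2 +
          ((((-1 : ℤˣ) : ℤ) : ℝ) * a 0 + ∑ i, ((ε i : ℤ) : ℝ) * a i.succ) ^ 2 =
        2 * a 0 ^ 2 + 2 * (∑ i, ((ε i : ℤ) : ℝ) * a i.succ) ^ 2 := fun ε => by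
      push_cast
      ring
    simp only [h, Finset.sum_add_distrib, ← Finset.mul_sum, ih fun i => a i.succ]
    simp
    ring

/-- The fourth moment of a Rademacher sum. -/
lemma sum_units_pow_four_le (n : ℕ) (a : Fin n → ℝ) :
    ∑ ε : Fin n → ℤˣ, (∑ i, ((ε i : ℤ) : ℝ) * a i) ^ 4 ≤ 2 ^ n * (3 * (∑ i, a i ^ 2) ^ 2) := by
  induction n with
  | zero => simp
  | succ n ih =>
    rw [sum_units_fin_succ]
    simp only [Fin.sum_univ_succ, Fin.cons_zero, Fin.cons_succ]
    have h : ∀ ε : Fin n → ℤˣ,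
        ((((1 : ℤˣ) : ℤ) : ℝ) * a 0 + ∑ i, ((ε i : ℤ) : ℝ) * a i.succ) ^ 4 +
          ((((-1 : ℤˣ) : ℤ) : ℝ) * a 0 + ∑ i, ((ε i : ℤ) : ℝ) * a i.succ) ^ 4 =
        2 * a 0 ^ 4 + 12 * a 0 ^ 2 * (∑ i, ((ε i : ℤ) : ℝ) * a i.succ) ^ 2 +
          2 * (∑ i, ((ε i : ℤ) : ℝ) * a i.succ) ^ 4 := fun ε => by
      push_cast
      ring
    have ih' := ih fun i => a i.succ
    simp only [h, Finset.sum_add_distrib, ← Finset.mul_sum, sum_units_sq n fun i => a i.succ]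
    simp only [Finset.sum_const, Finset.card_univ, Fintype.card_fun, Fintype.card_fin,
      Fintype.card_units_int, nsmul_eq_mul]
    push_cast
    have : (0 : ℝ) ≤ 2 ^ n * a 0 ^ 4 := by positivity
    rw [pow_succ (2 : ℝ) n]
    linarith

/-- Khinchine's inequality for the first moment, from the second and the fourth. -/
lemma khinchine_one (n : ℕ) (a : Fin n → ℝ) :
    2 ^ n * (5 / 9 * √(∑ i, a i ^ 2)) ≤ ∑ ε : Fin n → ℤˣ, |∑ i, ((ε i : ℤ) : ℝ) * a i| := by
  set σ := √(∑ i, a i ^ 2) with hσ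
  have hσ2 : ∑ i, a i ^ 2 = σ ^ 2 := (Real.sq_sqrt (Finset.sum_nonneg fun i _ => sq_nonneg _)).symm
  rcases (Real.sqrt_nonneg (∑ i, a i ^ 2)).eq_or_lt with h0 | hpos
  · rw [hσ, ← h0]
    simpa using Finset.sum_nonneg fun ε _ => abs_nonneg _
  rw [← hσ] at hpos
  -- the difference of the two sides is `t * (σ - 2 * t / 3) ^ 2 * (σ + t / 3)` with `t = |s|`
  have hpt : ∀ s : ℝ, σ ^ 2 * s ^ 2 - 4 / 27 * s ^ 4 ≤ σ ^ 3 * |s| := fun s => by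
    have h1 : 0 ≤ |s| * ((σ - 2 * |s| / 3) ^ 2 * (σ + |s| / 3)) := by positivity
    have h2 : s ^ 2 = |s| ^ 2 := (sq_abs s).symm
    have h4 : s ^ 4 = |s| ^ 4 := by rw [show s ^ 4 = (s ^ 2) ^ 2 by ring, h2]; ring
    rw [h2, h4]
    linarith
  have hsum := Finset.sum_le_sum fun (ε : Fin n → ℤˣ) (_ : ε ∈ Finset.univ) =>
    hpt (∑ i, ((ε i : ℤ) : ℝ) * a i)
  have h2 := sum_units_sq n a
  have h4 := sum_units_pow_four_le n a
  rw [Finset.sum_sub_distrib, ← Finset.mul_sum, ← Finset.mul_sum, ← Finset.mul_sum, h2, hσ2]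
    at hsum
  rw [hσ2] at h4
  refine le_of_mul_le_mul_left ?_ (pow_pos hpos 3)
  linarith

lemma sum_abs_le_sqrt_mul_sum_units (n : ℕ) (a : Fin n → ℝ) :
    2 ^ n * (5 / 9 * ∑ i, |a i|) ≤
      √n * ∑ ε : Fin n → ℤˣ, |∑ i, ((ε i : ℤ) : ℝ) * a i| := by
  have h1 : ∑ i, |a i| ≤ √n * √(∑ i, a i ^ 2) := by
    rw [← Real.sqrt_mul (by positivity)]
    refine Real.le_sqrt_of_sq_le ?_
    simpa using sq_sum_le_card_mul_sum_sq (s := Finset.univ) (f := fun i => |a i|)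
  calc 2 ^ n * (5 / 9 * ∑ i, |a i|) ≤ 2 ^ n * (5 / 9 * (√n * √(∑ i, a i ^ 2))) := by gcongr
    _ = √n * (2 ^ n * (5 / 9 * √(∑ i, a i ^ 2))) := by ring
    _ ≤ _ := by gcongr; exact khinchine_one n a

/-- Averaging over all signs, for each coordinate separately, yields signs for which the signed
sum of vectors in `ℓ¹` is large. For vectors of equal norms this is the cotype 2 inequality. -/
lemma exists_units_sum_norm_le (n : ℕ) (x : Fin n → EllOne) :
    ∃ ε : Fin n → ℤˣ, 5 / 9 * ∑ i, ‖x i‖ ≤ √n * ‖∑ i, ((ε i : ℤ) : ℝ) • x i‖ := by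
  have hcoe : ∀ (ε : Fin n → ℤˣ) (j : ℕ), (∑ i, ((ε i : ℤ) : ℝ) • x i) j =
      ∑ i, ((ε i : ℤ) : ℝ) * x i j := fun ε j => by
    rw [lp.coeFn_sum, Finset.sum_apply]
    rfl
  have hs1 : Summable fun j => ∑ i, |x i j| :=
    summable_sum fun i _ => lp.summable_norm_one (x i)
  have hs2 : ∀ ε : Fin n → ℤˣ, Summable fun j => |∑ i, ((ε i : ℤ) : ℝ) * x i j| := fun ε => by
    simpa only [hcoe, Real.norm_eq_abs] using lp.summable_norm_one (∑ i, ((ε i : ℤ) : ℝ) • x i)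
  have hnorm1 : ∑ i, ‖x i‖ = ∑' j, ∑ i, |x i j| := by
    refine (Finset.sum_congr rfl fun i _ => lp.norm_one_eq_tsum (x i)).trans ?_
    exact (Summable.tsum_finsetSum fun i _ => lp.summable_norm_one (x i)).symm
  have hnorm2 : ∑ ε : Fin n → ℤˣ, ‖∑ i, ((ε i : ℤ) : ℝ) • x i‖ =
      ∑' j, ∑ ε : Fin n → ℤˣ, |∑ i, ((ε i : ℤ) : ℝ) * x i j| := by
    rw [Summable.tsum_finsetSum fun ε _ => hs2 ε]
    simp only [lp.norm_one_eq_tsum, hcoe, Real.norm_eq_abs]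
  have key : 2 ^ n * (5 / 9 * ∑ i, ‖x i‖) ≤
      √n * ∑ ε : Fin n → ℤˣ, ‖∑ i, ((ε i : ℤ) : ℝ) • x i‖ := by
    rw [hnorm1, hnorm2, ← tsum_mul_left, ← tsum_mul_left, ← tsum_mul_left]
    exact Summable.tsum_le_tsum (fun j => sum_abs_le_sqrt_mul_sum_units n fun i => x i j)
      ((hs1.mul_left _).mul_left _) ((summable_sum fun ε _ => hs2 ε).mul_left _)
  have hsum : ∑ _ε : Fin n → ℤˣ, 5 / 9 * ∑ i, ‖x i‖ ≤
      ∑ ε : Fin n → ℤˣ, √n * ‖∑ i, ((ε i : ℤ) : ℝ) • x i‖ := by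
    rw [← Finset.mul_sum]
    simpa [mul_left_comm, ← Finset.mul_sum] using key
  obtain ⟨ε, -, hε⟩ := Finset.exists_le_of_sum_le Finset.univ_nonempty hsum
  exact ⟨ε, hε⟩

/-- If a space contains arbitrarily many vectors bounded below whose signed sums have norm of
order `n ^ s` with `s < 1 / 2`, then it does not embed into `ℓ¹`. -/
theorem not_isIsomorphicToSubspace_ellOne {X : Type*} [NormedAddCommGroup X] [NormedSpace ℝ X]
    {c s : ℝ} (hc : 0 < c) (hs : s < 1 / 2)
    (h : ∀ n : ℕ, ∃ e : Fin (n + 1) → X, (∀ i, c ≤ ‖e i‖) ∧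
      ∀ ε : Fin (n + 1) → ℤˣ, ‖∑ i, ((ε i : ℤ) : ℝ) • e i‖ ≤ ((n + 1 : ℕ) : ℝ) ^ s) :
    ¬ IsIsomorphicToSubspace X EllOne := by
  rintro ⟨V, ⟨T⟩⟩
  set A := ‖(T : X →L[ℝ] V)‖
  set B := ‖(T.symm : V →L[ℝ] X)‖
  have hB : 0 ≤ B := norm_nonneg (T.symm : V →L[ℝ] X)
  have hbound : ∀ n : ℕ, ((n + 1 : ℕ) : ℝ) ^ (1 / 2 - s) ≤ 9 / 5 * (A * B) / c := fun n => by
    obtain ⟨e, hec, he⟩ := h n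
    obtain ⟨ε, hε⟩ := exists_units_sum_norm_le (n + 1) fun i => (T (e i) : EllOne)
    have hN : (0 : ℝ) < ((n + 1 : ℕ) : ℝ) := by positivity
    have h1 : ‖∑ i, ((ε i : ℤ) : ℝ) • (T (e i) : EllOne)‖ ≤ A * ((n + 1 : ℕ) : ℝ) ^ s := by
      have h2 : ∑ i, ((ε i : ℤ) : ℝ) • (T (e i) : EllOne) =
          (T (∑ i, ((ε i : ℤ) : ℝ) • e i) : EllOne) := by
        simp [map_sum]
      rw [h2]
      exact ((T : X →L[ℝ] V).le_opNorm _).trans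
        (mul_le_mul_of_nonneg_left (he ε) (norm_nonneg _))
    have h3 : ((n + 1 : ℕ) : ℝ) * c ≤ B * ∑ i, ‖(T (e i) : EllOne)‖ := by
      rw [Finset.mul_sum]
      calc ((n + 1 : ℕ) : ℝ) * c = ∑ _i : Fin (n + 1), c := by simp
        _ ≤ _ := Finset.sum_le_sum fun i _ => (hec i).trans ?_
      have := (T.symm : V →L[ℝ] X).le_opNorm (T (e i))
      simpa using this
    have h4 : ((n + 1 : ℕ) : ℝ) * c ≤
        B * (9 / 5 * (√((n + 1 : ℕ) : ℝ) * (A * ((n + 1 : ℕ) : ℝ) ^ s))) := by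
      refine h3.trans (mul_le_mul_of_nonneg_left ?_ hB)
      have := mul_le_mul_of_nonneg_left h1 (Real.sqrt_nonneg ((n + 1 : ℕ) : ℝ))
      linarith
    have h5 : ((n + 1 : ℕ) : ℝ) ^ (1 / 2 - s) *
        (√((n + 1 : ℕ) : ℝ) * ((n + 1 : ℕ) : ℝ) ^ s) = ((n + 1 : ℕ) : ℝ) := by
      rw [Real.sqrt_eq_rpow, ← Real.rpow_add hN, ← Real.rpow_add hN]
      ring_nf
      simp
    have h6 : 0 < √((n + 1 : ℕ) : ℝ) * ((n + 1 : ℕ) : ℝ) ^ s := by positivity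
    rw [le_div_iff₀ hc]
    refine le_of_mul_le_mul_right ?_ h6
    calc ((n + 1 : ℕ) : ℝ) ^ (1 / 2 - s) * c * (√((n + 1 : ℕ) : ℝ) * ((n + 1 : ℕ) : ℝ) ^ s)
        = ((n + 1 : ℕ) : ℝ) * c := by rw [mul_right_comm, h5]
      _ ≤ _ := h4.trans_eq (by ring)
  have hlim : Tendsto (fun n : ℕ => ((n + 1 : ℕ) : ℝ) ^ (1 / 2 - s)) atTop atTop :=
    (tendsto_rpow_atTop (sub_pos.2 hs)).comp
      (tendsto_natCast_atTop_atTop.comp (tendsto_add_atTop_nat 1))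
  obtain ⟨n, hn⟩ := (hlim.eventually_gt_atTop (9 / 5 * (A * B) / c)).exists
  exact absurd (hbound n) (not_le.2 hn)

/-! ### Terenzi's space over the spaces `ℓₚⁿ` -/

/-- The signed sums of the `n + 1` unit vectors of the `n`-th block have norm at most
`(n + 1) ^ (1 / p)`, while the vectors themselves have norm at least `2 / 3`. -/
theorem TerenziSpace.not_isIsomorphicToSubspace_ellOne (p : ℝ≥0∞) [Fact (1 ≤ p)] (hp : 2 < p)
    (hp_top : p ≠ ⊤) :
    ¬ IsIsomorphicToSubspace (TerenziSpace fun k : ℕ => PiLp p fun _ : Fin (k + 1) => ℝ)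
      EllOne := by
  have hp2 : 2 < p.toReal := by
    simpa using (ENNReal.toReal_lt_toReal ENNReal.ofNat_ne_top hp_top).2 hp
  have hp0 : 0 < p.toReal := by linarith
  refine _root_.not_isIsomorphicToSubspace_ellOne (c := 2 / 3) (s := 1 / p.toReal) (by norm_num)
    (one_div_lt_one_div_of_lt two_pos hp2) fun n =>
      ⟨fun i => (equivLp _).symm (lpUnitVec p ⟨n, i⟩), fun i => ?_, fun ε => ?_⟩
  · rw [norm_equivLp_symm]
    refine le_trans ?_ (norm_le_terenziLimit _)
    rw [lpUnitVec, lp.norm_single one_pos, PiLp.norm_single]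
    simp
  · simp only [← map_smul, ← map_sum]
    rw [norm_equivLp_symm]
    refine (terenziLimit_le_norm _).trans ?_
    have h : ∑ i, ((ε i : ℤ) : ℝ) • lpUnitVec p (κ := fun k => Fin (k + 1)) ⟨n, i⟩ =
        lp.single 1 n (∑ i, ((ε i : ℤ) : ℝ) • PiLp.single p i (1 : ℝ)) := by
      simp only [← lp.lsingle_apply (𝕜 := ℝ), map_sum, map_smul]
      rfl
    rw [h, lp.norm_single one_pos, PiLp.norm_eq_sum hp0]
    have hε : ∀ i, ‖(∑ j, ((ε j : ℤ) : ℝ) • PiLp.single p j (1 : ℝ)) i‖ = 1 := fun i => by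
      rcases Int.units_eq_one_or (ε i) with hi | hi <;>
        simp [WithLp.ofLp_sum, Finset.sum_apply, Pi.single_apply, hi]
    simp only [hε, Real.one_rpow]
    simp

theorem mainTheorem3 (p : ℝ≥0∞) [Fact (1 ≤ p)] (hp : 2 < p) (hp_top : p ≠ ⊤) :
    ∃ (X : Type) (_ : NormedAddCommGroup X) (_ : NormedSpace ℝ X),
      CompleteSpace X ∧
      TopologicalSpace.SeparableSpace X ∧
      Nonempty (UnconditionalSchauderBasis ℕ ℝ X) ∧
      ¬ IsIsomorphicToSubspace X EllOne ∧
      ¬ HasEquilateralSequence X ∧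
      IsTerenziSum (fun k : ℕ => PiLp p (fun _ : Fin (k + 1) => ℝ)) X := by
  have : ∀ k : ℕ, StrictConvexSpace ℝ (PiLp p fun _ : Fin (k + 1) => ℝ) := fun _ =>
    PiLp.strictConvexSpace p (ENNReal.one_lt_two.trans hp) hp_top
  have : Infinite (Σ k : ℕ, Fin (k + 1)) :=
    Infinite.of_injective (fun k => ⟨k, 0⟩) fun _ _ h => congrArg Sigma.fst h
  obtain ⟨e⟩ := nonempty_equiv_of_countable (α := ℕ) (β := Σ k : ℕ, Fin (k + 1))
  let b := ((lpUnconditionalBasis p (κ := fun k => Fin (k + 1)) hp_top).map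
    (TerenziSpace.equivLp _).symm).reindex e
  exact ⟨TerenziSpace fun k : ℕ => PiLp p fun _ : Fin (k + 1) => ℝ, inferInstance, inferInstance,
    inferInstance, b.separableSpace, ⟨b⟩,
    TerenziSpace.not_isIsomorphicToSubspace_ellOne p hp hp_top,
    TerenziSpace.not_hasEquilateralSequence, TerenziSpace.isTerenziSum _⟩
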